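/- Let $\mathscr A$ be a (not necessarily unital) $C^*$-algebra and let $\mathscr X,\mathscr Y$ be Hilbert $\mathscr A$-modules. An operator $t$ from $\mathscr X$ to $\mathscr Y$ is a linear map $t:\mathrm{Dom}(t)\to\mathscr Y$ on a linear subspace $\mathrm{Dom}(t)\subseteq\mathscr X$; its range is $\mathrm{Ran}(t)$. Composites have their natural domain $\mathrm{Dom}(ts)=\{x\in\mathrm{Dom}(s): s(x)\in\mathrm{Dom}(t)\}$, and equality of operators includes equality of domains. The adjoint $t^*$ of a densely defined operator $t$ has domain $\{y\in\mathscr Y:\exists z\in\mathscr X\ \forall x\in\mathrm{Dom}(t)\ \langle t(x),y\rangle=\langle x,z\rangle\}$ and is given by $t^*(y)=z$. The operator $t$ is called regular if $\mathrm{Dom}(t)$ is a dense $\mathscr A$-submodule, $t$ is $\mathscr A$-linear and closed, $\mathrm{Dom}(t^*)$ is dense in $\mathscr Y$, and $1+t^*t$ has dense range in $\mathscr X$. A Moore–Penrose inverse of a regular operator $t$ from $\mathscr X$ to $\mathscr Y$ is a regular operator $s$ from $\mathscr Y$ to $\mathscr X$ with $tst=t$, $sts=s$, $(ts)^*=\overline{ts}$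 and $(st)^*=\overline{st}$, where the bar denotes the closure of an operator; if it exists and is unique, it is denoted by $t^\dagger$. Suppose that $t$ is a regular operator from $\mathscr X$ to $\mathscr Y$ with closed range and that $\mathrm{Ran}(t)\subseteq\mathrm{Dom}(t^*)$. Then the operators $t$, $t^*$, $t^*t$ and $tt^*$ are regular, each of them has a unique Moore–Penrose inverse, and 1. $t^\dagger=(t^*t)^\dagger\,t^*=t^*\,(tt^*)^\dagger$; 2. $(t^*t)^\dagger=t^\dagger\,(t^*)^\dagger$. -/

import Mathlib

/-! Unbounded operators between Hilbert C⋆-modules `X`, `Y` over a C⋆-algebra `A`.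

Hilbert C⋆-modules are Mathlib's `CStarModule A X` on a complete normed space, whose norm is
`‖x‖ = √‖⟪x, x⟫‖`. Mathlib writes the action of `A` as `a • x`, with
`⟪x, a • y⟫ = a * ⟪x, y⟫`; a right Hilbert module over a C⋆-algebra `B` is the case `A = Bᵐᵒᵖ`,
where `MulOpposite.op b • x` is `x b`. The module laws of the `A`-action follow from the
non-degeneracy of the inner product.

An operator from `X` to `Y` is a partially defined linear map `X →ₗ.[ℂ] Y`; equality of two such
maps includes equality of their domains. -/

noncomputable section

namespace HilbertModule

variable {X Y Z : Type*}

/-- The composition `t s`, with domain `{x ∈ Dom(s) | s x ∈ Dom(t)}`. -/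
def comp [AddCommGroup X] [Module ℂ X] [AddCommGroup Y] [Module ℂ Y] [AddCommGroup Z]
    [Module ℂ Z] (t : Y →ₗ.[ℂ] Z) (s : X →ₗ.[ℂ] Y) : X →ₗ.[ℂ] Z where
  domain :=
    { carrier := {x | ∃ h : x ∈ s.domain, s ⟨x, h⟩ ∈ t.domain}
      zero_mem' := ⟨s.domain.zero_mem, by
        have h0 : s ⟨0, s.domain.zero_mem⟩ = 0 := s.map_zero
        rw [h0]; exact t.domain.zero_mem⟩
      add_mem' := by
        rintro x y ⟨hx, hx'⟩ ⟨hy, hy'⟩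
        refine ⟨s.domain.add_mem hx hy, ?_⟩
        have h0 : s ⟨x + y, s.domain.add_mem hx hy⟩ = s ⟨x, hx⟩ + s ⟨y, hy⟩ :=
          s.map_add ⟨x, hx⟩ ⟨y, hy⟩
        rw [h0]; exact t.domain.add_mem hx' hy'
      smul_mem' := by
        rintro c x ⟨hx, hx'⟩
        refine ⟨s.domain.smul_mem c hx, ?_⟩
        have h0 : s ⟨c • x, s.domain.smul_mem c hx⟩ = c • s ⟨x, hx⟩ := s.map_smul c ⟨x, hx⟩
        rw [h0]; exact t.domain.smul_mem c hx' }
  toFun :=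
    { toFun := fun x => t ⟨s ⟨x, x.2.fst⟩, x.2.snd⟩
      map_add' := fun x y => by
        rw [← t.map_add]
        congr 1
        exact Subtype.ext (s.map_add ⟨x, x.2.fst⟩ ⟨y, y.2.fst⟩)
      map_smul' := fun c x => by
        rw [RingHom.id_apply, ← t.map_smul]
        congr 1
        exact Subtype.ext (s.map_smul c ⟨x, x.2.fst⟩) }

variable (A : Type*) [NonUnitalCStarAlgebra A] [PartialOrder A]
  [NormedAddCommGroup X] [NormedSpace ℂ X] [SMul A X] [CStarModule A X]
  [NormedAddCommGroup Y] [NormedSpace ℂ Y] [SMul A Y] [CStarModule A Y]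

/-- The pairs `(y, z)` with `⟪t x, y⟫ = ⟪x, z⟫` for all `x ∈ Dom(t)`. -/
def adjointGraph (t : X →ₗ.[ℂ] Y) : Submodule ℂ (Y × X) where
  carrier := {p | ∀ x : t.domain, inner A (t x) p.1 = inner A (x : X) p.2}
  zero_mem' := fun x => by simp
  add_mem' := fun {p q} hp hq x => by
    simp only [Prod.fst_add, Prod.snd_add, CStarModule.inner_add_right, hp x, hq x]
  smul_mem' := fun c p hp x => by
    simp only [Prod.smul_fst, Prod.smul_snd, CStarModule.inner_smul_right_complex, hp x]

/-- The adjoint `t*` of a densely defined operator `t`: its domain consists of the `y` for which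
some `z` satisfies `⟪t x, y⟫ = ⟪x, z⟫` for all `x ∈ Dom(t)`, and `t* y = z`. Here `z` is unique
because `Dom(t)` is dense; for other `t` the values are junk. -/
def adjoint (t : X →ₗ.[ℂ] Y) : Y →ₗ.[ℂ] X :=
  (adjointGraph A t).toLinearPMap

/-- Regular operators: `A`-linear, densely defined, closed, adjointable (that is, with densely
defined adjoint), and with `1 + t* t` of dense range. -/
structure IsRegular (t : X →ₗ.[ℂ] Y) : Prop where
  smul_mem : ∀ (a : A) (x : X), x ∈ t.domain → a • x ∈ t.domain
  map_smul : ∀ (a : A) (x : X) (hx : x ∈ t.domain),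
    t ⟨a • x, smul_mem a x hx⟩ = a • t ⟨x, hx⟩
  dense_domain : Dense (t.domain : Set X)
  isClosed : t.IsClosed
  dense_adjoint_domain : Dense ((adjoint A t).domain : Set Y)
  dense_range : Dense (Set.range fun x : (comp (adjoint A t) t).domain =>
    (x : X) + comp (adjoint A t) t x)

/-- `s` is a Moore–Penrose inverse of `t`: both are regular, `t s t = t`, `s t s = s`, and
`(t s)*`, `(s t)*` are the closures of `t s`, `s t`. (The operators `t s` and `s t` are densely
defined, since the first two equalities give them the domains of `s` and of `t`; the last two
equalities force them to be closable.) -/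
structure IsMoorePenroseInverse (t : X →ₗ.[ℂ] Y) (s : Y →ₗ.[ℂ] X) : Prop where
  regular_left : IsRegular A t
  regular_right : IsRegular A s
  comp_left : comp t (comp s t) = t
  comp_right : comp s (comp t s) = s
  adjoint_left : adjoint A (comp t s) = (comp t s).closure
  adjoint_right : adjoint A (comp s t) = (comp s t).closure

open Classical in
/-- The Moore–Penrose inverse `t†`, when `t` has one (junk value `0` otherwise). -/
def moorePenrose (t : X →ₗ.[ℂ] Y) : Y →ₗ.[ℂ] X :=
  if h : ∃ s : Y →ₗ.[ℂ] X, IsMoorePenroseInverse A t s then h.choose else 0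

end HilbertModule

end

/-! ### Invertibility by the method of continuity -/

section ContinuityMethod

variable {E : Type*} [NormedAddCommGroup E] [NormedSpace ℂ E] [CompleteSpace E]

/-! The hypothesis `Ran(t) ⊆ Dom(t*)` makes `t` bounded. On the graph of `t` the map `(x, t x) ↦ t*
t x` is everywhere defined and closed, hence bounded, and `⟪t x, t x⟫ = ⟪x, t* t x⟫` turns this into
`‖t x‖ ≤ C ‖x‖`. A closed, densely defined, bounded operator is everywhere defined, and the same
argument applies to `t*`. So `t = F` and `t* = G` are bounded and mutually adjoint.

For closed range, `F G` restricted to `Ran(F)` is positive and bounded below, hence invertible by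
the method of continuity. With `Q` the projection onto `Ran(F)`, the operator `S = G (F G)⁻¹ Q` is a
bounded Moore–Penrose inverse of `F` with an adjoint `S'`. Then `S'`, `S S'` and `S' S` serve `G`,
`G F` and `F G`, and the formulas are identities between bounded operators. Uniqueness must also
exclude unbounded competitors; this is `IsMoorePenroseInverse.eq_everywhere`. Regularity of the four
operators is part of `IsMoorePenroseInverse`. -/

theorem ContinuousLinearMap.isUnit_of_isUnit_add_smul {T : E →L[ℂ] E} {c r : ℝ} (hr : 0 ≤ r)
    (hrc : r < c) (hT : ∀ x, c * ‖x‖ ≤ ‖T x + (r : ℂ) • x‖)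
    (hu : IsUnit (T + (r : ℂ) • (1 : E →L[ℂ] E))) : IsUnit T := by
  obtain ⟨u, hu⟩ := hu
  have hc : 0 < c := hr.trans_lt hrc
  set v : E →L[ℂ] E := ↑u⁻¹
  have huv : (u : E →L[ℂ] E) * v = 1 := u.mul_inv
  have hv : ‖v‖ ≤ c⁻¹ := by
    refine ContinuousLinearMap.opNorm_le_bound _ (by positivity) fun x => ?_
    have h1 : T (v x) + (r : ℂ) • v x = x := by
      have := DFunLike.congr_fun huv x
      rwa [hu] at this
    have h2 := hT (v x)
    rw [h1] at h2
    rwa [inv_mul_eq_div, le_div_iff₀' hc]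
  -- With `v = (T + r)⁻¹` and `‖v‖ ≤ 1 / c`, the second factor is a Neumann series because `r / c <
  -- 1`.
  have hT' : T = u * (1 - (r : ℂ) • v) := by
    rw [mul_sub, mul_smul_comm, huv, mul_one, hu, add_sub_cancel_right]
  rw [hT']
  refine u.isUnit.mul (isUnit_one_sub_of_norm_lt_one ?_)
  rw [norm_smul, Complex.norm_real, Real.norm_of_nonneg hr]
  calc r * ‖v‖ ≤ r * c⁻¹ := by gcongr
    _ < 1 := by rwa [mul_inv_lt_iff₀ hc, one_mul]

/-- The method of continuity along the half-line `T + r`, `0 ≤ r`. -/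
theorem ContinuousLinearMap.isUnit_of_forall_le_norm_add_smul {T : E →L[ℂ] E} {c : ℝ} (hc : 0 < c)
    (hT : ∀ r : ℝ, 0 ≤ r → ∀ x, c * ‖x‖ ≤ ‖T x + (r : ℂ) • x‖) : IsUnit T := by
  have key : ∀ n : ℕ, IsUnit (T + ((n * (c / 2) : ℝ) : ℂ) • (1 : E →L[ℂ] E)) → IsUnit T := by
    intro n
    induction n with
    | zero => simp
    | succ n ih =>
      intro h
      refine ih (isUnit_of_isUnit_add_smul (r := c / 2) (c := c) (by positivity) (by linarith)
        (fun x => ?_) ?_)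
      · have := hT ((n + 1 : ℕ) * (c / 2)) (by positivity) x
        convert! this using 2
        simp only [add_apply, smul_apply, one_apply_eq_self, add_assoc, ← add_smul]
        congr 2
        push_cast
        ring
      · convert! h using 1
        rw [add_assoc, ← add_smul]
        congr 2
        push_cast
        ring
  -- The descent in steps of `c / 2 < c` starts at some `r > ‖T‖`, where `T + r` is invertible by a
  -- Neumann series.
  obtain ⟨n, hn⟩ := exists_nat_gt (‖T‖ / (c / 2))
  rw [div_lt_iff₀ (by positivity)] at hn
  have hr : 0 < (n : ℝ) * (c / 2) := (norm_nonneg _).trans_lt hn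
  refine key n ?_
  set r : ℝ := n * (c / 2)
  have hr' : (r : ℂ) ≠ 0 := by exact_mod_cast hr.ne'
  have h1 : T + (r : ℂ) • (1 : E →L[ℂ] E) = (r : ℂ) • (1 - (-((r : ℂ)⁻¹ • T))) := by
    rw [sub_neg_eq_add, smul_add, smul_smul, mul_inv_cancel₀ hr', one_smul, add_comm]
  rw [h1]
  refine (isUnit_smul_iff (Units.mk0 _ hr') _).2 (isUnit_one_sub_of_norm_lt_one ?_)
  rw [norm_neg, norm_smul, norm_inv, Complex.norm_real, Real.norm_of_nonneg hr.le,
    inv_mul_lt_iff₀ hr, mul_one]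
  exact hn

end ContinuityMethod

namespace HilbertModule

/-! ### Norm estimates from the `A`-valued inner product -/

section Inner

variable {A X Y : Type*} [NonUnitalCStarAlgebra A] [PartialOrder A]
  [NormedAddCommGroup X] [NormedSpace ℂ X] [SMul A X] [CStarModule A X]
  [NormedAddCommGroup Y] [NormedSpace ℂ Y] [SMul A Y] [CStarModule A Y]

variable (A) in
theorem ext_inner {x y : X} (h : ∀ v, inner A v x = inner A v y) : x = y := by
  rw [← sub_eq_zero, ← CStarModule.inner_self (A := A), CStarModule.inner_sub_right, h, sub_self]

variable [StarOrderedRing A]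

variable (A) in
theorem ext_inner_of_dense {s : Set X} (hs : Dense s) {x y : X}
    (h : ∀ v ∈ s, inner A v x = inner A v y) : x = y := by
  refine ext_inner A fun v => ?_
  have hc (z : X) : Continuous fun v : X => (inner A v z : A) :=
    CStarModule.continuous_inner.comp (Continuous.prodMk_left z)
  exact congr_fun (Continuous.ext_on hs (hc x) (hc y) h) v

theorem norm_sq_le_of_inner_self_eq {x : X} {y z : Y} (h : inner A x x = inner A y z) :
    ‖x‖ ^ 2 ≤ ‖y‖ * ‖z‖ := by
  rw [CStarModule.norm_sq_eq A, h]
  exact CStarModule.norm_inner_le Y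

/-- If `⟪x, z⟫ ≥ 0` then adding `r x` to `z` with `r ≥ 0` increases `⟪x, z⟫`. -/
theorem norm_inner_le_norm_mul_norm_add_smul {x z : X} (h : 0 ≤ (inner A x z : A)) {r : ℝ}
    (hr : 0 ≤ r) : ‖(inner A x z : A)‖ ≤ ‖x‖ * ‖z + (r : ℂ) • x‖ := by
  refine le_trans ?_ (CStarModule.norm_inner_le (A := A) X)
  refine CStarAlgebra.norm_le_norm_of_nonneg_of_le h ?_
  rw [CStarModule.inner_add_right, le_add_iff_nonneg_right, Complex.coe_smul,
    CStarModule.inner_smul_right_real]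
  exact smul_nonneg hr CStarModule.inner_self_nonneg

/-- Pair `z + r x` with `x`: the result dominates `r ⟪x, x⟫`, so Cauchy–Schwarz applies and one
factor `‖x‖` cancels. -/
theorem smul_norm_le_norm_add_smul {x z : X} (h : 0 ≤ (inner A x z : A)) {r : ℝ}
    (hr : 0 ≤ r) : r * ‖x‖ ≤ ‖z + (r : ℂ) • x‖ := by
  rcases eq_or_ne x 0 with rfl | hx
  · simp
  have hx' : 0 < ‖x‖ := norm_pos_iff.2 hx
  have h1 : ‖x‖ * (r * ‖x‖) ≤ ‖x‖ * ‖z + (r : ℂ) • x‖ := by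
    refine le_trans (le_of_eq ?_) ((CStarAlgebra.norm_le_norm_of_nonneg_of_le
      (a := r • (inner A x x : A)) (b := inner A x (z + (r : ℂ) • x))
      (smul_nonneg hr CStarModule.inner_self_nonneg) ?_).trans (CStarModule.norm_inner_le X))
    · rw [norm_smul, Real.norm_of_nonneg hr, ← CStarModule.norm_sq_eq]
      ring
    · rw [CStarModule.inner_add_right, Complex.coe_smul, CStarModule.inner_smul_right_real]
      exact le_add_of_nonneg_left h
  exact le_of_mul_le_mul_left h1 hx'

end Inner

/-! ### Bounded adjointable operators and their Moore–Penrose inverses -/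

section AdjointPair

variable (A : Type*) {X Y Z : Type*} [NonUnitalCStarAlgebra A] [PartialOrder A]
  [NormedAddCommGroup X] [NormedSpace ℂ X] [SMul A X] [CStarModule A X]
  [NormedAddCommGroup Y] [NormedSpace ℂ Y] [SMul A Y] [CStarModule A Y]
  [NormedAddCommGroup Z] [NormedSpace ℂ Z] [SMul A Z] [CStarModule A Z]

/-- The bounded operators `F` and `G` are adjoint to each other. -/
def IsAdjointPair (F : X →L[ℂ] Y) (G : Y →L[ℂ] X) : Prop :=
  ∀ x y, inner A (F x) y = inner A x (G y)

variable {A}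

namespace IsAdjointPair

theorem symm {F : X →L[ℂ] Y} {G : Y →L[ℂ] X} (h : IsAdjointPair A F G) :
    IsAdjointPair A G F := fun y x => by
  rw [← CStarModule.star_inner, ← h, CStarModule.star_inner]

theorem comp {F : X →L[ℂ] Y} {G : Y →L[ℂ] X} {F' : Y →L[ℂ] Z} {G' : Z →L[ℂ] Y}
    (h' : IsAdjointPair A F' G') (h : IsAdjointPair A F G) :
    IsAdjointPair A (F' ∘L F) (G ∘L G') := fun x z => by
  rw [ContinuousLinearMap.comp_apply, h', h, ContinuousLinearMap.comp_apply]

theorem unique {F : X →L[ℂ] Y} {G G' : Y →L[ℂ] X} (h : IsAdjointPair A F G)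
    (h' : IsAdjointPair A F G') : G = G' := by
  ext y
  exact ext_inner A fun v => by rw [← h, h']

theorem map_smul {F : X →L[ℂ] Y} {G : Y →L[ℂ] X} (h : IsAdjointPair A F G) (a : A) (x : X) :
    F (a • x) = a • F x :=
  ext_inner A fun v => by
    rw [← h.symm, CStarModule.inner_op_smul_right, CStarModule.inner_op_smul_right, h.symm]

/-- Since `⟪x, G F x⟫ = ⟪F x, F x⟫ ≥ 0`, every `1 + G F + r` with `r ≥ 0` is bounded below by `1`.
-/
theorem isUnit_one_add [StarOrderedRing A] [CompleteSpace X] {F : X →L[ℂ] Y} {G : Y →L[ℂ] X}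
    (h : IsAdjointPair A F G) : IsUnit (1 + G ∘L F) := by
  refine ContinuousLinearMap.isUnit_of_forall_le_norm_add_smul one_pos fun r hr x => ?_
  have h0 : 0 ≤ (inner A x (G (F x)) : A) := by
    rw [← h]
    exact CStarModule.inner_self_nonneg
  have h1 := smul_norm_le_norm_add_smul h0 (add_nonneg hr zero_le_one)
  have h2 : (1 + G ∘L F) x + (r : ℂ) • x = G (F x) + ((r + 1 : ℝ) : ℂ) • x := by
    push_cast
    rw [add_smul, one_smul]
    change x + G (F x) + (r : ℂ) • x = _
    abel
  rw [h2]
  refine le_trans ?_ h1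
  gcongr
  linarith

/-- A bounded operator that has an adjoint and closed range has a Moore–Penrose inverse, which
again has an adjoint. -/
theorem exists_moorePenrose [StarOrderedRing A] [CompleteSpace X] [CompleteSpace Y]
    {F : X →L[ℂ] Y} {G : Y →L[ℂ] X} (h : IsAdjointPair A F G) (hF : IsClosed (Set.range F)) :
    ∃ (S : Y →L[ℂ] X) (S' : X →L[ℂ] Y), IsAdjointPair A S S' ∧ F ∘L S ∘L F = F ∧
      S ∘L F ∘L S = S ∧ IsAdjointPair A (F ∘L S) (F ∘L S) ∧ IsAdjointPair A (S ∘L F) (S ∘L F) := by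
  let R : Submodule ℂ Y := F.range
  have hR : IsClosed (R : Set Y) := hF
  have : CompleteSpace R := hR.completeSpace_coe
  let F₀ : X →L[ℂ] R := F.codRestrict R fun x => ⟨x, rfl⟩
  have hF₀ (x : X) : (F₀ x : Y) = F x := rfl
  have hsurj : Function.Surjective F₀ := by
    rintro ⟨_, x, rfl⟩
    exact ⟨x, rfl⟩
  -- Open mapping theorem; this is where closedness of the range enters. Writing `u = F x` with `‖x‖
  -- ≤ k ‖u‖` shows that `G` is bounded below on `R`.
  obtain ⟨k, hk, hpre⟩ := F₀.exists_preimage_norm_le hsurj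
  let T : R →L[ℂ] R := F₀ ∘L G ∘L R.subtypeL
  have hT (u : R) : (T u : Y) = F (G u) := rfl
  have hpos (u v : R) : (inner A (u : Y) (T v : Y) : A) = inner A (G u) (G v) := by
    rw [hT, h.symm]
  have hG (u : R) : ‖u‖ ≤ k * ‖G u‖ := by
    obtain ⟨x, hx, hxk⟩ := hpre u
    have hxu : F x = u := by rw [← hF₀, hx]
    rcases eq_or_ne u 0 with rfl | hu
    · simp
    have hu' : 0 < ‖u‖ := norm_pos_iff.2 hu
    have h1 : ‖(u : Y)‖ ^ 2 ≤ ‖x‖ * ‖G u‖ := by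
      refine norm_sq_le_of_inner_self_eq (A := A) ?_
      rw [← h, hxu]
    have h2 : ‖u‖ * ‖u‖ ≤ ‖u‖ * (k * ‖G u‖) := by
      calc ‖u‖ * ‖u‖ = ‖(u : Y)‖ ^ 2 := by rw [sq]; rfl
        _ ≤ ‖x‖ * ‖G u‖ := h1
        _ ≤ k * ‖u‖ * ‖G u‖ := by gcongr
        _ = _ := by ring
    exact le_of_mul_le_mul_left h2 hu'
  have hunit : IsUnit T := by
    -- The constant comes from `‖u‖² ≤ k² ‖G u‖² = k² ‖⟪u, T u⟫‖ ≤ k² ‖u‖ ‖T u + r u‖`.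
    refine ContinuousLinearMap.isUnit_of_forall_le_norm_add_smul (c := (k ^ 2)⁻¹) (by positivity)
      fun r hr u => ?_
    rcases eq_or_ne u 0 with rfl | hu
    · simp
    have hu' : 0 < ‖u‖ := norm_pos_iff.2 hu
    have h0 : 0 ≤ (inner A (u : Y) (T u : Y) : A) := by
      rw [hpos]
      exact CStarModule.inner_self_nonneg
    have h1 := norm_inner_le_norm_mul_norm_add_smul h0 hr
    rw [hpos, ← CStarModule.norm_sq_eq A] at h1
    have h2 : ‖u‖ * ‖u‖ ≤ ‖u‖ * (k ^ 2 * ‖T u + (r : ℂ) • u‖) := by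
      calc ‖u‖ * ‖u‖ ≤ (k * ‖G u‖) * (k * ‖G u‖) := by gcongr <;> exact hG u
        _ = k ^ 2 * ‖G u‖ ^ 2 := by ring
        _ ≤ k ^ 2 * (‖u‖ * ‖T u + (r : ℂ) • u‖) := by gcongr; exact h1
        _ = _ := by ring
    rw [inv_mul_le_iff₀ (by positivity)]
    exact le_of_mul_le_mul_left h2 hu'
  obtain ⟨V, hV⟩ := hunit
  let W : R →L[ℂ] R := ↑V⁻¹
  have hTW (u : R) : T (W u) = u := by
    rw [← hV]
    exact DFunLike.congr_fun V.mul_inv u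
  have hWT (u : R) : W (T u) = u := by
    rw [← hV]
    exact DFunLike.congr_fun V.inv_mul u
  have hTsymm (u v : R) : (inner A (T u : Y) (v : Y) : A) = inner A (u : Y) (T v : Y) := by
    rw [← CStarModule.star_inner, hpos, CStarModule.star_inner, hpos]
  have hWsymm (u v : R) : (inner A (W u : Y) (v : Y) : A) = inner A (u : Y) (W v : Y) := by
    conv_lhs => rw [← hTW v]
    rw [← hTsymm, hTW]
  -- the orthogonal projection onto the range
  let Q : Y →L[ℂ] R := W ∘L F₀ ∘L G
  have hQ (u : R) : Q u = u := hWT u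
  have hGQ (y : Y) : G (Q y) = G y := by
    have h1 : T (Q y) = F₀ (G y) := hTW _
    -- For `v = Q y - y` this gives `⟪G v, G v⟫ = ⟪F G v, v⟫ = 0`.
    have h2 : F (G (Q y - y)) = 0 := by
      rw [map_sub, map_sub, sub_eq_zero, ← hT, h1, hF₀]
    rw [← sub_eq_zero, ← map_sub, ← CStarModule.inner_self (A := A), ← h, h2,
      CStarModule.inner_zero_left]
  have hinner (x : X) (y : Y) : (inner A (F x) (Q y : Y) : A) = inner A (F x) y := by
    rw [h, hGQ, ← h]
  have hQsymm (y y' : Y) : (inner A (Q y : Y) y' : A) = inner A y (Q y' : Y) := by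
    have h1 (y y' : Y) : (inner A (Q y : Y) y' : A) = inner A (Q y : Y) (Q y' : Y) := by
      obtain ⟨x, hx⟩ := hsurj (Q y)
      rw [← hx, hF₀, hinner]
    rw [h1, ← CStarModule.star_inner, ← h1, CStarModule.star_inner]
  let S : Y →L[ℂ] X := G ∘L R.subtypeL ∘L W ∘L Q
  have hFS (y : Y) : F (S y) = Q y := congr_arg Subtype.val (hTW (Q y))
  have hSF (x : X) : S (F x) = G (W (F₀ x) : Y) := by
    change G (W (Q (F₀ x : Y)) : Y) = _
    rw [hQ]
  refine ⟨S, R.subtypeL ∘L W ∘L F₀, ?_, ?_, ?_, ?_, ?_⟩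
  · intro y x
    change inner A (G (W (Q y) : Y)) x = inner A y (W (F₀ x) : Y)
    rw [h.symm, ← hF₀, hWsymm, hQsymm, hQ]
  · ext x
    change F (S (F x)) = F x
    rw [hFS, ← hF₀, hQ]
  · ext y
    change S (F (S y)) = S y
    rw [hFS]
    change G (W (Q (Q y : Y)) : Y) = G (W (Q y) : Y)
    rw [hQ]
  · intro y y'
    change inner A (F (S y)) y' = inner A y (F (S y'))
    rw [hFS, hFS, hQsymm]
  · intro x x'
    change inner A (S (F x)) x' = inner A x (S (F x'))
    rw [hSF, hSF, h.symm, ← h, ← hF₀, ← hF₀, hWsymm]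

end IsAdjointPair

end AdjointPair

/-! ### Operators as graphs; everywhere defined operators -/

section Graph

variable {X Y Z : Type*}

theorem mem_graph_comp [AddCommGroup X] [Module ℂ X] [AddCommGroup Y] [Module ℂ Y]
    [AddCommGroup Z] [Module ℂ Z] {t : Y →ₗ.[ℂ] Z} {s : X →ₗ.[ℂ] Y} {x : X} {z : Z} :
    (x, z) ∈ (comp t s).graph ↔ ∃ y, (x, y) ∈ s.graph ∧ (y, z) ∈ t.graph := by
  constructor
  · rw [LinearPMap.mem_graph_iff]
    rintro ⟨⟨x, hx, hsx⟩, rfl, rfl⟩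
    exact ⟨s ⟨x, hx⟩, s.mem_graph ⟨x, hx⟩, t.mem_graph ⟨_, hsx⟩⟩
  · rintro ⟨y, h1, h2⟩
    rw [LinearPMap.mem_graph_iff] at h1 h2
    obtain ⟨⟨x, hx⟩, rfl, rfl⟩ := h1
    obtain ⟨⟨_, hy⟩, rfl, h2⟩ := h2
    exact (LinearPMap.mem_graph_iff _).2 ⟨⟨x, hx, hy⟩, rfl, h2⟩

variable [NormedAddCommGroup X] [NormedSpace ℂ X] [NormedAddCommGroup Y] [NormedSpace ℂ Y]
  [NormedAddCommGroup Z] [NormedSpace ℂ Z]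

/-- A bounded operator, as an operator with domain the whole space. -/
def everywhere (F : X →L[ℂ] Y) : X →ₗ.[ℂ] Y := (F : X →ₗ[ℂ] Y).toPMap ⊤

theorem mem_graph_everywhere {F : X →L[ℂ] Y} {x : X} {y : Y} :
    (x, y) ∈ (everywhere F).graph ↔ F x = y := by
  rw [LinearPMap.mem_graph_iff]
  constructor
  · rintro ⟨x, rfl, rfl⟩
    rfl
  · rintro rfl
    exact ⟨⟨x, trivial⟩, rfl, rfl⟩

theorem comp_everywhere (F : Y →L[ℂ] Z) (G : X →L[ℂ] Y) :
    comp (everywhere F) (everywhere G) = everywhere (F ∘L G) := by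
  refine LinearPMap.eq_of_eq_graph ?_
  ext ⟨x, z⟩
  rw [mem_graph_comp, mem_graph_everywhere]
  simp only [mem_graph_everywhere, exists_eq_left', ContinuousLinearMap.comp_apply]

theorem isClosed_everywhere (F : X →L[ℂ] Y) : (everywhere F).IsClosed := by
  have h : ((everywhere F).graph : Set (X × Y)) = {p | F p.1 = p.2} := by
    ext ⟨x, y⟩
    exact mem_graph_everywhere
  rw [LinearPMap.IsClosed, h]
  exact isClosed_eq (by fun_prop) (by fun_prop)

theorem closure_eq_of_isClosed {f : X →ₗ.[ℂ] Y} (hf : f.IsClosed) : f.closure = f := by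
  refine LinearPMap.eq_of_eq_graph ?_
  rw [← hf.isClosable.graph_closure_eq_closure_graph]
  exact IsClosed.submodule_topologicalClosure_eq hf

/-- The set of `x` with `(x, F x)` in the graph of `f` is closed and contains the dense domain. -/
theorem eq_everywhere_of_graph_le {f : X →ₗ.[ℂ] Y} (hf : f.IsClosed)
    (hd : Dense (f.domain : Set X)) {F : X →L[ℂ] Y} (h : ∀ x y, (x, y) ∈ f.graph → y = F x) :
    f = everywhere F := by
  have hall (x : X) : (x, F x) ∈ f.graph := by
    have hc : IsClosed {x : X | (x, F x) ∈ f.graph} :=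
      hf.preimage (f := fun x : X => (x, F x)) (by fun_prop)
    have hsub : (f.domain : Set X) ⊆ {x : X | (x, F x) ∈ f.graph} := fun x hx => by
      have h1 := f.mem_graph ⟨x, hx⟩
      rwa [h _ _ h1] at h1
    exact hc.closure_subset_iff.2 hsub (hd x)
  refine LinearPMap.eq_of_eq_graph ?_
  ext ⟨x, y⟩
  rw [mem_graph_everywhere]
  constructor
  · exact fun hxy => (h _ _ hxy).symm
  · rintro rfl
    exact hall x

theorem eq_everywhere_of_bound [CompleteSpace X] [CompleteSpace Y] {f : X →ₗ.[ℂ] Y}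
    (hf : f.IsClosed) (hd : Dense (f.domain : Set X)) {C : ℝ}
    (hC : ∀ x : f.domain, ‖f x‖ ≤ C * ‖x‖) : ∃ F : X →L[ℂ] Y, f = everywhere F := by
  let g : f.domain →L[ℂ] Y := f.toFun.mkContinuous C hC
  let F : X →L[ℂ] Y := g.extend f.domain.subtypeL
  refine ⟨F, eq_everywhere_of_graph_le hf hd fun x y hxy => ?_⟩
  rw [LinearPMap.mem_graph_iff] at hxy
  obtain ⟨x, rfl, rfl⟩ := hxy
  refine (ContinuousLinearMap.extend_eq g ?_ ?_ x).symm
  · simpa [DenseRange] using hd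
  · exact isUniformInducing_val _

end Graph

/-! ### Adjoints, regularity, and uniqueness among unbounded operators -/

section Adjoint

variable {A X Y : Type*} [NonUnitalCStarAlgebra A] [PartialOrder A] [StarOrderedRing A]
  [NormedAddCommGroup X] [NormedSpace ℂ X] [SMul A X] [CStarModule A X]
  [NormedAddCommGroup Y] [NormedSpace ℂ Y] [SMul A Y] [CStarModule A Y]

theorem graph_adjoint {t : X →ₗ.[ℂ] Y} (ht : Dense (t.domain : Set X)) :
    (adjoint A t).graph = adjointGraph A t := by
  refine Submodule.toLinearPMap_graph_eq _ ?_
  rintro ⟨y, z⟩ hyz (rfl : y = 0)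
  refine ext_inner_of_dense A ht fun x hx => ?_
  have := hyz ⟨x, hx⟩
  simp only [CStarModule.inner_zero_right] at this ⊢
  exact this.symm

theorem mem_graph_adjoint {t : X →ₗ.[ℂ] Y} (ht : Dense (t.domain : Set X)) {y : Y} {z : X} :
    (y, z) ∈ (adjoint A t).graph ↔ ∀ x : t.domain, inner A (t x) y = inner A (x : X) z := by
  rw [graph_adjoint ht]
  rfl

theorem inner_adjoint {t : X →ₗ.[ℂ] Y} (ht : Dense (t.domain : Set X)) (x : t.domain)
    (y : (adjoint A t).domain) : inner A (t x) (y : Y) = inner A (x : X) (adjoint A t y) :=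
  (mem_graph_adjoint ht).1 ((adjoint A t).mem_graph y) x

theorem isClosed_adjoint {t : X →ₗ.[ℂ] Y} (ht : Dense (t.domain : Set X)) :
    (adjoint A t).IsClosed := by
  have h : ((adjoint A t).graph : Set (Y × X)) =
      ⋂ x : t.domain, {p | (inner A (t x) p.1 : A) = inner A (x : X) p.2} := by
    ext ⟨y, z⟩
    rw [SetLike.mem_coe, mem_graph_adjoint ht, Set.mem_iInter]
    rfl
  rw [LinearPMap.IsClosed, h]
  exact isClosed_iInter fun x => isClosed_eq
    (CStarModule.continuous_inner.comp (by fun_prop : Continuous fun p : Y × X => (t x, p.1)))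
    (CStarModule.continuous_inner.comp (by fun_prop : Continuous fun p : Y × X => ((x : X), p.2)))

theorem dense_domain_everywhere (F : X →L[ℂ] Y) : Dense ((everywhere F).domain : Set X) := by
  have h : ((everywhere F).domain : Set X) = Set.univ := rfl
  rw [h]
  exact dense_univ

theorem adjoint_everywhere {F : X →L[ℂ] Y} {G : Y →L[ℂ] X} (h : IsAdjointPair A F G) :
    adjoint A (everywhere F) = everywhere G := by
  refine LinearPMap.eq_of_eq_graph ?_
  ext ⟨y, z⟩
  rw [mem_graph_adjoint (dense_domain_everywhere F), mem_graph_everywhere]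
  constructor
  · intro hx
    refine ext_inner A fun v => ?_
    rw [← h]
    exact hx ⟨v, trivial⟩
  · rintro rfl x
    exact h x y

theorem isAdjointPair_of_adjoint_everywhere {F : X →L[ℂ] Y} {G : Y →L[ℂ] X}
    (h : adjoint A (everywhere F) = everywhere G) : IsAdjointPair A F G := fun x y => by
  have h1 : (y, G y) ∈ (adjoint A (everywhere F)).graph := by
    rw [h, mem_graph_everywhere]
  exact (mem_graph_adjoint (dense_domain_everywhere F)).1 h1 ⟨x, trivial⟩

theorem isRegular_everywhere [CompleteSpace X] {F : X →L[ℂ] Y} {G : Y →L[ℂ] X}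
    (h : IsAdjointPair A F G) : IsRegular A (everywhere F) where
  smul_mem _ _ _ := trivial
  map_smul a x _ := h.map_smul a x
  dense_domain := dense_domain_everywhere F
  isClosed := isClosed_everywhere F
  dense_adjoint_domain := by
    rw [adjoint_everywhere h]
    exact dense_domain_everywhere G
  dense_range := by
    rw [adjoint_everywhere h, comp_everywhere]
    refine Function.Surjective.denseRange fun x => ?_
    obtain ⟨u, hu⟩ := h.isUnit_one_add
    refine ⟨⟨(↑u⁻¹ : X →L[ℂ] X) x, trivial⟩, ?_⟩
    have := DFunLike.congr_fun u.mul_inv x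
    rwa [hu] at this

theorem isMoorePenroseInverse_everywhere [CompleteSpace X] [CompleteSpace Y]
    {F : X →L[ℂ] Y} {G : Y →L[ℂ] X} {S : Y →L[ℂ] X} {S' : X →L[ℂ] Y}
    (h : IsAdjointPair A F G) (hS : IsAdjointPair A S S')
    (h1 : F ∘L S ∘L F = F) (h2 : S ∘L F ∘L S = S)
    (h3 : IsAdjointPair A (F ∘L S) (F ∘L S)) (h4 : IsAdjointPair A (S ∘L F) (S ∘L F)) :
    IsMoorePenroseInverse A (everywhere F) (everywhere S) where
  regular_left := isRegular_everywhere h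
  regular_right := isRegular_everywhere hS
  comp_left := by rw [comp_everywhere, comp_everywhere, h1]
  comp_right := by rw [comp_everywhere, comp_everywhere, h2]
  adjoint_left := by
    rw [comp_everywhere, adjoint_everywhere h3, closure_eq_of_isClosed (isClosed_everywhere _)]
  adjoint_right := by
    rw [comp_everywhere, adjoint_everywhere h4, closure_eq_of_isClosed (isClosed_everywhere _)]

/-- Such a `q` is symmetric, because it is contained in its closure, which is `q*`. -/
theorem inner_eq_of_adjoint_eq_closure {q : X →ₗ.[ℂ] X} (hd : Dense (q.domain : Set X))
    (h : adjoint A q = q.closure) {x y x' y' : X} (hxy : (x, y) ∈ q.graph)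
    (hxy' : (x', y') ∈ q.graph) : inner A y x' = inner A x y' := by
  have h1 := LinearPMap.le_graph_of_le q.le_closure hxy'
  rw [← h, mem_graph_adjoint hd] at h1
  rw [LinearPMap.mem_graph_iff] at hxy
  obtain ⟨x, rfl, rfl⟩ := hxy
  exact h1 x

/-- A bounded Moore–Penrose inverse of a bounded operator is the only one, also among the
unbounded operators. -/
theorem IsMoorePenroseInverse.eq_everywhere {F : X →L[ℂ] Y} {S : Y →L[ℂ] X}
    (h1 : F ∘L S ∘L F = F) (h2 : S ∘L F ∘L S = S)
    (h3 : IsAdjointPair A (F ∘L S) (F ∘L S)) (h4 : IsAdjointPair A (S ∘L F) (S ∘L F))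
    {s : Y →ₗ.[ℂ] X} (hs : IsMoorePenroseInverse A (everywhere F) s) : s = everywhere S := by
  have hFSF (x : X) : F (S (F x)) = F x := DFunLike.congr_fun h1 x
  have hSFS (y : Y) : S (F (S y)) = S y := DFunLike.congr_fun h2 y
  have hfun {y : Y} {z z' : X} (hz : (y, z) ∈ s.graph) (hz' : (y, z') ∈ s.graph) : z = z' :=
    s.mem_graph_snd_inj' hz hz' rfl
  -- The domain part of `F s F = F` puts `Ran(F)` inside `Dom(s)`, so `P = s F` is everywhere
  -- defined.
  have hP (x : X) : ∃ w, (F x, w) ∈ s.graph ∧ F w = F x := by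
    have hx : (x, F x) ∈ (everywhere F).graph := mem_graph_everywhere.2 rfl
    rw [← hs.comp_left, mem_graph_comp] at hx
    obtain ⟨w, hw, hw'⟩ := hx
    rw [mem_graph_comp] at hw
    obtain ⟨y, hy, hyw⟩ := hw
    rw [mem_graph_everywhere] at hy hw'
    exact ⟨w, hy ▸ hyw, hw'⟩
  choose P hP hFP using hP
  have hs_fix {y : Y} {z : X} (hyz : (y, z) ∈ s.graph) : P z = z := by
    have h := hyz
    rw [← hs.comp_right, mem_graph_comp] at h
    obtain ⟨v, hv, hvz⟩ := h
    rw [mem_graph_comp] at hv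
    obtain ⟨z', hz', hv'⟩ := hv
    rw [mem_graph_everywhere] at hv'
    subst hv'
    rw [hfun hz' hyz] at hvz
    exact hfun (hP z) hvz
  have hq_graph {y : Y} {z : X} (hyz : (y, z) ∈ s.graph) :
      (y, F z) ∈ (comp (everywhere F) s).graph :=
    mem_graph_comp.2 ⟨z, hyz, mem_graph_everywhere.2 rfl⟩
  have hp_graph (x : X) : (x, P x) ∈ (comp s (everywhere F)).graph :=
    mem_graph_comp.2 ⟨F x, mem_graph_everywhere.2 rfl, hP x⟩
  have hq_dense : Dense ((comp (everywhere F) s).domain : Set Y) :=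
    hs.regular_right.dense_domain.mono fun y hy => ⟨hy, trivial⟩
  have hp_dense : Dense ((comp s (everywhere F)).domain : Set X) := by
    refine dense_univ.mono fun x _ => ?_
    exact LinearPMap.mem_domain_of_mem_graph (hp_graph x)
  -- `P` and `S F` are symmetric and `P = P S F`; moving both across the inner product gives `P = S
  -- F P = S F`, as `F P = F`.
  have hPSF (x : X) : P x = S (F x) := by
    refine ext_inner A fun v => ?_
    have hv : P (S (F v)) = P v := by
      refine hfun (hP _) ?_
      rw [hFSF]
      exact hP v
    rw [← inner_eq_of_adjoint_eq_closure hp_dense hs.adjoint_right (hp_graph v) (hp_graph x), ← hv,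
      inner_eq_of_adjoint_eq_closure hp_dense hs.adjoint_right (hp_graph _) (hp_graph x)]
    exact (h4 v (P x)).trans (by rw [ContinuousLinearMap.comp_apply, hFP])
  refine eq_everywhere_of_graph_le hs.regular_right.isClosed hs.regular_right.dense_domain
    fun y z hyz => ?_
  -- `F s` is symmetric and fixes `F S y'`, so `⟪F S y', y⟫ = ⟪F S y', F z⟫`; moving `F S` to the
  -- right gives `⟪y', F S y⟫ = ⟪y', F z⟫`.
  have hFz : F z = F (S y) := by
    refine ext_inner_of_dense A hs.regular_right.dense_domain fun y' hy' => ?_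
    have h5 := inner_eq_of_adjoint_eq_closure hq_dense hs.adjoint_left
      (hq_graph (hP (S y'))) (hq_graph hyz)
    rw [hFP] at h5
    have h6 := h3 y' (F z)
    have h7 := h3 y' y
    simp only [ContinuousLinearMap.comp_apply] at h6 h7
    rw [← h7, h5, ← hFSF z, ← h6, hFSF]
  -- `z = P z = S F z = S F S y = S y`.
  rw [← hs_fix hyz, hPSF, hFz, hSFS]

theorem existsUnique_isMoorePenroseInverse_everywhere [CompleteSpace X] [CompleteSpace Y]
    {F : X →L[ℂ] Y} {G : Y →L[ℂ] X} {S : Y →L[ℂ] X} {S' : X →L[ℂ] Y}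
    (h : IsAdjointPair A F G) (hS : IsAdjointPair A S S')
    (h1 : F ∘L S ∘L F = F) (h2 : S ∘L F ∘L S = S)
    (h3 : IsAdjointPair A (F ∘L S) (F ∘L S)) (h4 : IsAdjointPair A (S ∘L F) (S ∘L F)) :
    (∃! s, IsMoorePenroseInverse A (everywhere F) s) ∧
      moorePenrose A (everywhere F) = everywhere S := by
  have hex := isMoorePenroseInverse_everywhere h hS h1 h2 h3 h4
  refine ⟨⟨_, hex, fun s hs => hs.eq_everywhere h1 h2 h3 h4⟩, ?_⟩
  have h' : ∃ s, IsMoorePenroseInverse A (everywhere F) s := ⟨_, hex⟩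
  rw [moorePenrose, dif_pos h']
  exact h'.choose_spec.eq_everywhere h1 h2 h3 h4

end Adjoint

/-! ### Boundedness from `Ran(t) ⊆ Dom(t*)` -/

section Bounded

variable {A X Y : Type*} [NonUnitalCStarAlgebra A] [PartialOrder A] [StarOrderedRing A]
  [NormedAddCommGroup X] [NormedSpace ℂ X] [CompleteSpace X] [SMul A X] [CStarModule A X]
  [NormedAddCommGroup Y] [NormedSpace ℂ Y] [CompleteSpace Y] [SMul A Y] [CStarModule A Y]

/-- A closed operator whose range lies in the domain of its adjoint is bounded: by the closed
graph theorem `t* t` is bounded for the graph norm of `t`. -/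
theorem exists_bound_of_range_subset {t : X →ₗ.[ℂ] Y} (hd : Dense (t.domain : Set X))
    (ht : t.IsClosed) (hrange : Set.range t ⊆ ((adjoint A t).domain : Set Y)) :
    ∃ C : ℝ, ∀ x : t.domain, ‖t x‖ ≤ C * ‖x‖ := by
  have hgraph (p : t.graph) : p.1.2 ∈ (adjoint A t).domain := by
    obtain ⟨x, -, hx⟩ := (LinearPMap.mem_graph_iff t).1 p.2
    exact hrange ⟨x, hx⟩
  have : CompleteSpace t.graph := (show IsClosed (t.graph : Set (X × Y)) from ht).completeSpace_coe
  let φ : t.graph →ₗ[ℂ] X := (adjoint A t).toFun ∘ₗ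
    ((LinearMap.snd ℂ X Y ∘ₗ t.graph.subtype).codRestrict _ hgraph)
  have hφ (p : t.graph) : φ p = adjoint A t ⟨p.1.2, hgraph p⟩ := rfl
  have hcont : Continuous φ := by
    refine φ.continuous_of_isClosed_graph ?_
    have heq : (φ.graph : Set (t.graph × X)) =
        (fun q : t.graph × X => (q.1.1.2, q.2)) ⁻¹' ((adjoint A t).graph : Set (Y × X)) := by
      ext ⟨p, x⟩
      rw [Set.mem_preimage, SetLike.mem_coe, SetLike.mem_coe, LinearMap.mem_graph_iff, hφ,
        LinearPMap.mem_graph_iff]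
      constructor
      · exact fun hx => ⟨⟨_, hgraph p⟩, rfl, hx.symm⟩
      · rintro ⟨⟨_, hy⟩, rfl, hx⟩
        exact hx.symm
    rw [heq]
    exact (isClosed_adjoint hd).preimage (by fun_prop)
  let Φ : t.graph →L[ℂ] X := ⟨φ, hcont⟩
  refine ⟨‖Φ‖ + 1, fun x => ?_⟩
  let p : t.graph := ⟨(x, t x), t.mem_graph x⟩
  have h1 : ‖t x‖ ^ 2 ≤ ‖(x : X)‖ * ‖Φ p‖ := by
    refine norm_sq_le_of_inner_self_eq (A := A) ?_
    exact inner_adjoint hd x ⟨t x, hgraph p⟩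
  have hp : ‖p‖ ≤ ‖(x : X)‖ + ‖t x‖ :=
    max_le (le_add_of_nonneg_right (norm_nonneg _)) (le_add_of_nonneg_left (norm_nonneg _))
  have h2 : ‖Φ p‖ ≤ ‖Φ‖ * (‖(x : X)‖ + ‖t x‖) := (Φ.le_opNorm p).trans (by gcongr)
  have h3 : ‖t x‖ ^ 2 ≤ ‖(x : X)‖ * (‖Φ‖ * (‖(x : X)‖ + ‖t x‖)) :=
    h1.trans (by gcongr)
  have hC : 0 ≤ ‖Φ‖ := Φ.opNorm_nonneg
  have ha : 0 ≤ ‖(x : X)‖ := norm_nonneg _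
  have hb : 0 ≤ ‖t x‖ := norm_nonneg _
  change ‖t x‖ ≤ (‖Φ‖ + 1) * ‖(x : X)‖
  generalize ‖Φ‖ = C at *
  generalize ‖(x : X)‖ = a at *
  generalize ‖t x‖ = b at *
  -- With `b² ≤ C a (a + b)` and `b > (C + 1) a`, one gets `(C + 1) a² ≤ a b < C a²`.
  by_contra! hlt
  have h4 : (C + 1) * a * b ≤ b * b := by gcongr
  have h5 : (C + 1) * a * a ≤ b * a := by gcongr
  have hb' : 0 < b := lt_of_le_of_lt (by positivity) hlt
  have h6 : (C + 1) * a * b < b * b := by gcongr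
  nlinarith [mul_nonneg ha ha]

/-- Once `t = F` is bounded, `z = t* y` satisfies `⟪z, z⟫ = ⟪F z, y⟫`, so `‖z‖ ≤ ‖F‖ ‖y‖` and `t*`
is everywhere defined too. -/
theorem exists_isAdjointPair_of_range_subset {t : X →ₗ.[ℂ] Y} (ht : IsRegular A t)
    (hrange : Set.range t ⊆ ((adjoint A t).domain : Set Y)) :
    ∃ (F : X →L[ℂ] Y) (G : Y →L[ℂ] X), IsAdjointPair A F G ∧ t = everywhere F := by
  obtain ⟨C, hC⟩ := exists_bound_of_range_subset ht.dense_domain ht.isClosed hrange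
  obtain ⟨F, rfl⟩ := eq_everywhere_of_bound ht.isClosed ht.dense_domain hC
  have hbound (y : (adjoint A (everywhere F)).domain) :
      ‖adjoint A (everywhere F) y‖ ≤ ‖F‖ * ‖y‖ := by
    set z := adjoint A (everywhere F) y
    rcases eq_or_ne z 0 with hz | hz
    · rw [hz, norm_zero]
      positivity
    have hz' : 0 < ‖z‖ := norm_pos_iff.2 hz
    have h1 : ‖z‖ ^ 2 ≤ ‖F z‖ * ‖(y : Y)‖ := by
      refine norm_sq_le_of_inner_self_eq (A := A) ?_
      exact (inner_adjoint ht.dense_domain ⟨z, trivial⟩ y).symm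
    have h2 : ‖z‖ * ‖z‖ ≤ ‖z‖ * (‖F‖ * ‖y‖) :=
      calc ‖z‖ * ‖z‖ = ‖z‖ ^ 2 := (sq _).symm
        _ ≤ ‖F z‖ * ‖(y : Y)‖ := h1
        _ ≤ ‖F‖ * ‖z‖ * ‖(y : Y)‖ := by gcongr; exact F.le_opNorm z
        _ = ‖z‖ * (‖F‖ * ‖(y : Y)‖) := by ring
    exact le_of_mul_le_mul_left h2 hz'
  obtain ⟨G, hG⟩ := eq_everywhere_of_bound (isClosed_adjoint ht.dense_domain)
    ht.dense_adjoint_domain hbound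
  exact ⟨F, G, isAdjointPair_of_adjoint_everywhere hG, rfl⟩

end Bounded

end HilbertModule

/-! ### The theorem, by algebra of bounded operators -/

open HilbertModule in
/-- For a regular operator `t` with closed range and `Ran(t) ⊆ Dom(t*)`, the regular operators `t`,
`t*`, `t* t`, `t t*` have unique Moore–Penrose inverses, and
`t† = (t* t)† t* = t* (t t*)†`, `(t* t)† = t† (t*)†`. -/
theorem corollary2p3 {A X Y : Type*} [NonUnitalCStarAlgebra A] [PartialOrder A] [StarOrderedRing A]
    [NormedAddCommGroup X] [NormedSpace ℂ X] [CompleteSpace X] [SMul A X] [CStarModule A X]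
    [NormedAddCommGroup Y] [NormedSpace ℂ Y] [CompleteSpace Y] [SMul A Y] [CStarModule A Y]
    (t : X →ₗ.[ℂ] Y) (ht : IsRegular A t)
    (hclosed : IsClosed (Set.range t))
    (hrange : Set.range t ⊆ ((adjoint A t).domain : Set Y)) :
    ((∃! s, IsMoorePenroseInverse A t s) ∧
      (∃! s, IsMoorePenroseInverse A (adjoint A t) s) ∧
      (∃! s, IsMoorePenroseInverse A (comp (adjoint A t) t) s) ∧
      (∃! s, IsMoorePenroseInverse A (comp t (adjoint A t)) s)) ∧
    (moorePenrose A t = comp (moorePenrose A (comp (adjoint A t) t)) (adjoint A t) ∧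
      moorePenrose A t = comp (adjoint A t) (moorePenrose A (comp t (adjoint A t)))) ∧
    moorePenrose A (comp (adjoint A t) t) =
      comp (moorePenrose A t) (moorePenrose A (adjoint A t)) := by
  obtain ⟨F, G, h, rfl⟩ := exists_isAdjointPair_of_range_subset ht hrange
  have hF : IsClosed (Set.range F) := by
    convert hclosed using 1
    ext y
    exact ⟨fun ⟨x, hx⟩ => ⟨⟨x, trivial⟩, hx⟩, fun ⟨x, hx⟩ => ⟨x, hx⟩⟩
  obtain ⟨S, S', hS, h1, h2, h3, h4⟩ := h.exists_moorePenrose hF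
  -- taking adjoints in `(F S)* = F S` and `(S F)* = S F`
  have hS'G : S' ∘L G = F ∘L S := (h.comp hS).unique h3
  have hGS' : G ∘L S' = S ∘L F := (hS.comp h).unique h4
  have e1 (x : X) : F (S (F x)) = F x := DFunLike.congr_fun h1 x
  have e2 (y : Y) : S (F (S y)) = S y := DFunLike.congr_fun h2 y
  have e3 (y : Y) : S' (G y) = F (S y) := DFunLike.congr_fun hS'G y
  have e4 (x : X) : G (S' x) = S (F x) := DFunLike.congr_fun hGS' x
  have e5 (y : Y) : G (F (S y)) = G y := by
    have : G ∘L F ∘L S = G :=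
      (h3.comp h).unique (by rw [ContinuousLinearMap.comp_assoc, h1]; exact h)
    exact DFunLike.congr_fun this y
  have e6 (x : X) : S' (S (F x)) = S' x := by
    have : S' ∘L S ∘L F = S' :=
      (h4.comp hS).unique (by rw [ContinuousLinearMap.comp_assoc, h2]; exact hS)
    exact DFunLike.congr_fun this x
  have e7 (y : Y) : S (S' (G y)) = S y := by rw [e3, e2]
  have e8 (y : Y) : G (S' (S y)) = S y := by rw [e4, e2]
  -- The products of `G F` with `S S'`, and of `F G` with `S' S`, collapse in either order to the
  -- self-adjoint idempotents `S F` and `F S`.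
  have c1 : (G ∘L F) ∘L (S ∘L S') = S ∘L F := by
    ext x
    change G (F (S (S' x))) = S (F x)
    rw [e5, e4]
  have c2 : (S ∘L S') ∘L (G ∘L F) = S ∘L F := by
    ext x
    change S (S' (G (F x))) = S (F x)
    rw [e7]
  have c3 : (F ∘L G) ∘L (S' ∘L S) = F ∘L S := by
    ext y
    change F (G (S' (S y))) = F (S y)
    rw [e8]
  have c4 : (S' ∘L S) ∘L (F ∘L G) = F ∘L S := by
    ext y
    change S' (S (F (G y))) = F (S y)
    rw [e6, e3]
  obtain ⟨u1, m1⟩ := existsUnique_isMoorePenroseInverse_everywhere h hS h1 h2 h3 h4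
  obtain ⟨u2, m2⟩ := existsUnique_isMoorePenroseInverse_everywhere h.symm hS.symm
    (by rw [hS'G]; ext y; exact e5 y) (by rw [hGS']; ext x; exact e6 x)
    (by rw [hGS']; exact h4) (by rw [hS'G]; exact h3)
  obtain ⟨u3, m3⟩ := existsUnique_isMoorePenroseInverse_everywhere
    (h.symm.comp h) (hS.comp hS.symm)
    (by rw [c2]; ext x; exact congr_arg G (e1 x)) (by rw [c1]; ext x; exact congr_arg S (e6 x))
    (by rw [c1]; exact h4) (by rw [c2]; exact h4)
  obtain ⟨u4, m4⟩ := existsUnique_isMoorePenroseInverse_everywhere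
    (h.comp h.symm) (hS.symm.comp hS)
    (by rw [c4]; ext y; exact congr_arg F (e5 y)) (by rw [c3]; ext y; exact congr_arg S' (e2 y))
    (by rw [c3]; exact h3) (by rw [c4]; exact h3)
  rw [adjoint_everywhere h, comp_everywhere, comp_everywhere, m1, m2, m3, m4, comp_everywhere,
    comp_everywhere, comp_everywhere]
  refine ⟨⟨u1, u2, u3, u4⟩, ⟨congr_arg _ ?_, congr_arg _ ?_⟩, rfl⟩
  · ext y
    exact (e7 y).symm
  · ext y
    exact (e8 y).symm
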